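/- Let $(X,Y),(X_1,Y_1),(X_2,Y_2),\dots$ be i.i.d. pairs of real random variables such that $X$ and $Y$ are independent, $P\{Y\ge 0\}=1$, $P\{Y>0\}>0$ and $E|X|<\infty$. Put \[ T_n=\frac{\sum_{i=1}^n X_iY_i}{\sum_{i=1}^n Y_i}\qquad(0/0:=0). \] Assume that the condition \[ \limsup_{x\to\infty}\frac{x\,E\big(Y\,I(Y\le x)\big)}{x^2P\{Y>x\}+E\big(Y^2I(Y\le x)\big)}<\infty \] does not hold. Then there exist a subsequence $\{n'\}$ of $\{n\}$ and a random variable $T$ such that $T_{n'}$ converges in distribution to $T$ along $\{n'\}$ and $P\{T=EX\}>0$. -/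

import Mathlib

open MeasureTheory ProbabilityTheory Filter

noncomputable section

/-- The self-normalized weighted sum `T_n = (∑_{i<n} X_i Y_i) / (∑_{i<n} Y_i)`, with the
convention `0 / 0 = 0`. (The sequences are indexed from `0`, so there are `n` summands.) -/
def selfNormalizedSum {Ω : Type*} (X Y : ℕ → Ω → ℝ) (n : ℕ) (ω : Ω) : ℝ :=
  (∑ i ∈ Finset.range n, X i ω * Y i ω) / ∑ i ∈ Finset.range n, Y i ω

/-- The ratio `x E(Y 1{Y ≤ x}) / (x² P(Y > x) + E(Y² 1{Y ≤ x}))`. -/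
def truncatedMomentRatio {Ω : Type*} [MeasurableSpace Ω] (P : Measure Ω) (Y : Ω → ℝ)
    (x : ℝ) : ℝ :=
  (x * ∫ ω in {ω | Y ω ≤ x}, Y ω ∂P) /
    (x ^ 2 * P.real {ω | x < Y ω} + ∫ ω in {ω | Y ω ≤ x}, Y ω ^ 2 ∂P)

/-- Griffin's condition: the upper limit of the truncated moment ratio as `x → ∞`, taken in
the extended reals, is finite. -/
def GriffinCondition {Ω : Type*} [MeasurableSpace Ω] (P : Measure Ω) (Y : Ω → ℝ) : Prop :=
  limsup (fun x : ℝ => (truncatedMomentRatio P Y x : EReal)) atTop < ⊤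

end

/-!
The limit can be taken to be the constant `E X`: the whole self-normalized sum converges to `E X`
in probability along a subsequence.

Write `W = Y 1{Y ≤ x}`, `m = E W`, `v = E W²`, `p = P(Y > x)`. If Griffin's condition fails, then
for every `r` there is `x > 0` with `x m > r (x² p + v)`. Taking `n = ⌈x / m⌉` gives `n p ≤ 2 / r`
and `v ≤ n m² / r`, and then `n ≥ r` because `m² ≤ v` (`exists_level_of_not_griffin`). So with
probability close to one no `Y i` with `i < n` exceeds `x`, and `∑ W i` is close to its mean `n m`
by Chebyshev's inequality.

To bound `∑ (X i - E X) W i` against `n m` when `X` is only integrable, split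
`X - E X = f(X) + e(X)` with `f` bounded, `E f(X) = 0` and `E |e(X)|` small
(`exists_bounded_centred_approx`). Since `X` and `Y` are independent, the first part has variance
at most `n C² v`, which is at most `C² (n m)² / r`, and the second has `L¹` norm at most
`n m E |e(X)|`. This gives closeness to `E X` in probability for arbitrarily large `n`
(`frequently_measureReal_abs_sub_ge_le`), from which a subsequence is extracted.
-/

/-- The truncation `y ↦ y 1{y ≤ x}` at level `x`. -/
noncomputable def truncAt (x y : ℝ) : ℝ := (Set.Iic x).indicator id y

lemma measurable_truncAt (x : ℝ) : Measurable (truncAt x) :=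
  measurable_id.indicator measurableSet_Iic

lemma truncAt_of_le {x y : ℝ} (h : y ≤ x) : truncAt x y = y :=
  Set.indicator_of_mem (s := Set.Iic x) h id

lemma abs_truncAt_le {x y : ℝ} (hy : 0 ≤ y) : |truncAt x y| ≤ |x| := by
  by_cases h : y ≤ x
  · rw [truncAt_of_le h, abs_of_nonneg hy]
    exact h.trans (le_abs_self x)
  · rw [truncAt, Set.indicator_of_notMem (s := Set.Iic x) h]
    simp

lemma truncAt_nonneg {x y : ℝ} (hy : 0 ≤ y) : 0 ≤ truncAt x y :=
  Set.indicator_apply_nonneg fun _ => hy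

/-- If all weights are at most `x`, their sum exceeds half its truncated mean, and both parts of
the centred weighted sum are small, then the self-normalized sum is close to `μ`. -/
lemma abs_selfNormalizedSum_sub_lt {Ω : Type*} {X Y : ℕ → Ω → ℝ} {n : ℕ} {ω : Ω} {f : ℝ → ℝ} {x μ b ε : ℝ}
    (hb : 0 < b) (hYx : ∀ i ∈ Finset.range n, Y i ω ≤ x)
    (hsum : |∑ i ∈ Finset.range n, truncAt x (Y i ω) - b| < b / 2)
    (hf : |∑ i ∈ Finset.range n, f (X i ω) * truncAt x (Y i ω)| < ε * b / 4)
    (he : |∑ i ∈ Finset.range n, (X i ω - μ - f (X i ω)) * truncAt x (Y i ω)| < ε * b / 4) :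
    |selfNormalizedSum X Y n ω - μ| < ε := by
  have hW : ∀ i ∈ Finset.range n, truncAt x (Y i ω) = Y i ω := fun i hi => truncAt_of_le (hYx i hi)
  rw [Finset.sum_congr rfl hW] at hsum
  rw [Finset.sum_congr rfl fun i hi => by rw [hW i hi]] at hf
  rw [Finset.sum_congr rfl fun i hi => by rw [hW i hi]] at he
  have hS : b / 2 < ∑ i ∈ Finset.range n, Y i ω := by linarith [(abs_lt.mp hsum).1]
  have hS0 : 0 < ∑ i ∈ Finset.range n, Y i ω := (half_pos hb).trans hS
  have hε : 0 < ε := by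
    have := (abs_nonneg _).trans_lt hf
    by_contra h
    nlinarith
  have heq : selfNormalizedSum X Y n ω - μ =
      (∑ i ∈ Finset.range n, f (X i ω) * Y i ω +
        ∑ i ∈ Finset.range n, (X i ω - μ - f (X i ω)) * Y i ω) /
        ∑ i ∈ Finset.range n, Y i ω := by
    rw [selfNormalizedSum, eq_div_iff hS0.ne', sub_mul, div_mul_cancel₀ _ hS0.ne',
      Finset.mul_sum, ← Finset.sum_sub_distrib, ← Finset.sum_add_distrib]
    exact Finset.sum_congr rfl fun i _ => by ring
  rw [heq, abs_div, abs_of_pos hS0, div_lt_iff₀ hS0]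
  calc _ ≤ _ := abs_add_le _ _
    _ < ε * (b / 2) := by linarith
    _ ≤ _ := by gcongr

section

variable {Ω : Type*} [MeasurableSpace Ω] {P : Measure Ω}

lemma memLp_truncAt [IsProbabilityMeasure P] {V : Ω → ℝ} (hV : Measurable V)
    (hV0 : ∀ᵐ ω ∂P, 0 ≤ V ω) (x : ℝ) (p : ENNReal) :
    MemLp (fun ω => truncAt x (V ω)) p P :=
  MemLp.of_bound ((measurable_truncAt x).comp hV).aestronglyMeasurable |x|
    (hV0.mono fun _ h => abs_truncAt_le h)

lemma setIntegral_eq_integral_truncAt {V : Ω → ℝ} (hV : Measurable V) (x : ℝ) :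
    ∫ ω in {ω | V ω ≤ x}, V ω ∂P = ∫ ω, truncAt x (V ω) ∂P :=
  (integral_indicator (hV measurableSet_Iic)).symm

lemma setIntegral_sq_eq_integral_truncAt_sq {V : Ω → ℝ} (hV : Measurable V) (x : ℝ) :
    ∫ ω in {ω | V ω ≤ x}, V ω ^ 2 ∂P = ∫ ω, truncAt x (V ω) ^ 2 ∂P := by
  have hs : MeasurableSet {ω | V ω ≤ x} := hV measurableSet_Iic
  rw [← integral_indicator hs]
  refine integral_congr_ae (Eventually.of_forall fun ω => ?_)
  by_cases h : V ω ≤ x <;> simp [truncAt, Set.indicator, h]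

/-- If Griffin's condition fails, then for every `r` there are a truncation level `x` and a sample
size `n ≥ r` such that with high probability none of `n` copies of `V` exceeds `x`, while the sum
of the truncated copies has standard deviation much smaller than its mean. -/
lemma exists_level_of_not_griffin [IsProbabilityMeasure P] {V : Ω → ℝ} (hV : Measurable V)
    (hV0 : ∀ᵐ ω ∂P, 0 ≤ V ω) (hg : ¬ GriffinCondition P V) {r : ℝ} (hr : 0 < r) :
    ∃ (x : ℝ) (n : ℕ), r ≤ n ∧ n * P.real {ω | x < V ω} ≤ 2 / r ∧
      0 < ∫ ω, truncAt x (V ω) ∂P ∧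
      r * ∫ ω, truncAt x (V ω) ^ 2 ∂P ≤ n * (∫ ω, truncAt x (V ω) ∂P) ^ 2 := by
  have hfreq : ∃ᶠ x : ℝ in atTop, (r : EReal) < (truncatedMomentRatio P V x : EReal) := by
    refine frequently_lt_of_lt_limsup (by isBoundedDefault) ?_
    rw [GriffinCondition, not_lt, top_le_iff] at hg
    rw [hg]
    exact EReal.coe_lt_top r
  obtain ⟨x, hxr, hx⟩ := (hfreq.and_eventually (eventually_gt_atTop 0)).exists
  rw [EReal.coe_lt_coe_iff, truncatedMomentRatio, setIntegral_eq_integral_truncAt hV,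
    setIntegral_sq_eq_integral_truncAt_sq hV] at hxr
  set p := P.real {ω | x < V ω}
  set m := ∫ ω, truncAt x (V ω) ∂P with hm_def
  set v := ∫ ω, truncAt x (V ω) ^ 2 ∂P with hv_def
  have hp : 0 ≤ p := measureReal_nonneg
  have hv : 0 ≤ v := integral_nonneg fun ω => sq_nonneg _
  have hmx : m ≤ x := by
    calc m ≤ ∫ _, x ∂P := by
          refine integral_mono_ae ((memLp_truncAt hV hV0 x 1).integrable le_rfl)
            (integrable_const x) (hV0.mono fun ω h => ?_)
          exact (le_abs_self _).trans ((abs_truncAt_le h).trans (abs_of_pos hx).le)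
      _ = x := by simp
  have hD : 0 < x ^ 2 * p + v := by
    refine lt_of_le_of_ne (by positivity) fun h => ?_
    rw [← h, div_zero] at hxr
    exact absurd hxr hr.not_gt
  rw [lt_div_iff₀ hD] at hxr
  have hm : 0 < m := by
    have : 0 < x * m := lt_trans (by positivity) hxr
    exact pos_of_mul_pos_right this hx.le
  have hn1 : x ≤ ⌈x / m⌉₊ * m := by
    rw [← div_le_iff₀ hm]; exact Nat.le_ceil _
  have hn2 : ⌈x / m⌉₊ * m ≤ 2 * x := by
    have := (Nat.ceil_lt_add_one (by positivity : 0 ≤ x / m)).le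
    calc ⌈x / m⌉₊ * m ≤ (x / m + 1) * m := by gcongr
      _ = x + m := by field_simp
      _ ≤ 2 * x := by linarith
  have hrv : r * v ≤ ⌈x / m⌉₊ * m ^ 2 := by
    have h1 : r * v ≤ x * m := by
      have : 0 ≤ r * (x ^ 2 * p) := by positivity
      linarith
    calc r * v ≤ x * m := h1
      _ ≤ (⌈x / m⌉₊ * m) * m := by gcongr
      _ = _ := by ring
  refine ⟨x, ⌈x / m⌉₊, ?_, ?_, hm, hrv⟩
  · -- Since `m ^ 2 ≤ v` by Jensen's inequality, the bound on `v` forces `n` to be large.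
    have hvar := variance_nonneg (fun ω => truncAt x (V ω)) P
    rw [variance_eq_sub (memLp_truncAt hV hV0 x 2)] at hvar
    have hmv : m ^ 2 ≤ v := sub_nonneg.mp hvar
    refine le_of_mul_le_mul_right (le_trans ?_ hrv) (pow_pos hm 2)
    gcongr
  · rw [le_div_iff₀ hr]
    have h1 : (r * p * x) * x ≤ m * x := by nlinarith
    have h2 : r * p * x ≤ m := le_of_mul_le_mul_right h1 hx
    have h3 : (⌈x / m⌉₊ * p * r) * x ≤ 2 * x := by
      calc (⌈x / m⌉₊ * p * r) * x = ⌈x / m⌉₊ * (r * p * x) := by ring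
        _ ≤ ⌈x / m⌉₊ * m := by gcongr
        _ ≤ 2 * x := hn2
    exact le_of_mul_le_mul_right h3 hx

/-- Chebyshev's inequality for a sum of i.i.d. square-integrable variables. -/
lemma measureReal_abs_sum_sub_ge_le [IsProbabilityMeasure P] {U : ℕ → Ω → ℝ}
    (hindep : Pairwise fun i j => IndepFun (U i) (U j) P)
    (hident : ∀ i, IdentDistrib (U i) (U 0) P P) (hL2 : MemLp (U 0) 2 P) (n : ℕ) {c : ℝ}
    (hc : 0 < c) :
    P.real {ω | c ≤ |∑ i ∈ Finset.range n, U i ω - n * ∫ ω, U 0 ω ∂P|} ≤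
      n * (∫ ω, U 0 ω ^ 2 ∂P) / c ^ 2 := by
  have hL (i : ℕ) : MemLp (U i) 2 P := (hident i).memLp_iff.mpr hL2
  have hsum : MemLp (∑ i ∈ Finset.range n, U i) 2 P := memLp_finsetSum' _ fun i _ => hL i
  have hvar : variance (∑ i ∈ Finset.range n, U i) P = n * variance (U 0) P := by
    rw [IndepFun.variance_sum (fun i _ => hL i) (fun i _ j _ hij => hindep hij)]
    simp [fun i => (hident i).variance_eq]
  have hmean : ∫ ω, (∑ i ∈ Finset.range n, U i) ω ∂P = n * ∫ ω, U 0 ω ∂P := by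
    simp only [Finset.sum_apply]
    rw [integral_finsetSum _ fun i _ => (hL i).integrable one_le_two]
    simp [fun i => (hident i).integral_eq]
  have hle : variance (U 0) P ≤ ∫ ω, U 0 ω ^ 2 ∂P := by
    simpa using variance_le_expectation_sq hL2.aestronglyMeasurable
  have key := meas_ge_le_variance_div_sq hsum hc
  rw [hmean, hvar] at key
  simp only [Finset.sum_apply] at key
  have hnn : 0 ≤ n * variance (U 0) P / c ^ 2 := by
    have := variance_nonneg (U 0) P
    positivity
  refine (ENNReal.toReal_le_of_le_ofReal hnn key).trans ?_
  gcongr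

/-- Markov's inequality for a sum of identically distributed integrable variables. -/
lemma measureReal_abs_sum_ge_le {U : ℕ → Ω → ℝ}
    (hident : ∀ i, IdentDistrib (U i) (U 0) P P) (hL1 : Integrable (U 0) P) (n : ℕ) {c : ℝ}
    (hc : 0 < c) :
    P.real {ω | c ≤ |∑ i ∈ Finset.range n, U i ω|} ≤ n * (∫ ω, |U 0 ω| ∂P) / c := by
  have hL (i : ℕ) : Integrable (U i) P := (hident i).integrable_iff.mpr hL1
  rw [le_div_iff₀' hc]
  refine (mul_meas_ge_le_integral_of_nonneg (Eventually.of_forall fun ω => abs_nonneg _)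
    (integrable_finsetSum _ fun i _ => hL i).abs c).trans ?_
  calc ∫ ω, |∑ i ∈ Finset.range n, U i ω| ∂P
      ≤ ∫ ω, ∑ i ∈ Finset.range n, |U i ω| ∂P :=
        integral_mono (integrable_finsetSum _ fun i _ => hL i).abs
          (integrable_finsetSum _ fun i _ => (hL i).abs) fun ω => Finset.abs_sum_le_sum_abs _ _
    _ = ∑ i ∈ Finset.range n, ∫ ω, |U i ω| ∂P := integral_finsetSum _ fun i _ => (hL i).abs
    _ = n * ∫ ω, |U 0 ω| ∂P := by
        have (i : ℕ) : ∫ ω, |U i ω| ∂P = ∫ ω, |U 0 ω| ∂P := ((hident i).norm).integral_eq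
        simp [this]

/-- An integrable variable is, up to a small error in `L¹`, its mean plus a centred bounded
function of itself. -/
lemma exists_bounded_centred_approx [IsProbabilityMeasure P] {Z : Ω → ℝ} (hZ : Measurable Z) (hint : Integrable Z P)
    {δ : ℝ} (hδ : 0 < δ) :
    ∃ (f : ℝ → ℝ) (C : ℝ), Measurable f ∧ (∀ t, |f t| ≤ C) ∧ ∫ ω, f (Z ω) ∂P = 0 ∧
      ∫ ω, |Z ω - (∫ ω', Z ω' ∂P) - f (Z ω)| ∂P ≤ δ := by
  have : IsProbabilityMeasure (P.map Z) := Measure.isProbabilityMeasure_map hZ.aemeasurable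
  have hid : Integrable (fun t : ℝ => t) (P.map Z) :=
    (integrable_map_measure aestronglyMeasurable_id hZ.aemeasurable).mpr hint
  obtain ⟨g, hg, -⟩ := hid.exists_boundedContinuous_integral_sub_le (half_pos hδ)
  have hgm : Measurable g := g.continuous.measurable
  rw [integral_map hZ.aemeasurable (by fun_prop)] at hg
  simp only [Real.norm_eq_abs] at hg
  have hgi : Integrable (fun ω => g (Z ω)) P :=
    Integrable.of_bound (hgm.comp hZ).aestronglyMeasurable ‖g‖
      (Eventually.of_forall fun ω => g.norm_coe_le_norm _)
  set a := ∫ ω, g (Z ω) ∂P with ha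
  set μ := ∫ ω, Z ω ∂P with hμ
  have hdiff : |a - μ| ≤ δ / 2 := by
    rw [abs_sub_comm, ha, hμ, ← integral_sub hint hgi]
    exact (abs_integral_le_integral_abs).trans hg
  refine ⟨fun t => g t - a, ‖g‖ + |a|, hgm.sub_const a, fun t => ?_, ?_, ?_⟩
  · exact (abs_sub _ _).trans (by gcongr; exact g.norm_coe_le_norm t)
  · rw [integral_sub hgi (integrable_const a)]
    simp [ha]
  · calc ∫ ω, |Z ω - μ - (g (Z ω) - a)| ∂P ≤ ∫ ω, (|Z ω - g (Z ω)| + |a - μ|) ∂P := by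
          refine integral_mono
            (((hint.sub (integrable_const μ)).sub (hgi.sub (integrable_const a))).abs)
            ((hint.sub hgi).abs.add (integrable_const _)) fun ω => ?_
          have : Z ω - μ - (g (Z ω) - a) = (Z ω - g (Z ω)) + (a - μ) := by ring
          simp only [this]
          exact abs_add_le _ _
      _ = ∫ ω, |Z ω - g (Z ω)| ∂P + |a - μ| := by
          have habs : Integrable (fun ω => |Z ω - g (Z ω)|) P := (hint.sub hgi).abs
          rw [integral_add habs (integrable_const _)]; simp
      _ ≤ δ := by linarith

/-- When Griffin's condition fails, the self-normalized sum is close to `E X` in probability for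
arbitrarily large sample sizes. -/
lemma frequently_measureReal_abs_sub_ge_le [IsProbabilityMeasure P] {X Y : ℕ → Ω → ℝ}
    (hX : ∀ i, Measurable (X i)) (hY : ∀ i, Measurable (Y i))
    (hindep : iIndepFun (fun i ω => (X i ω, Y i ω)) P)
    (hident : ∀ i, IdentDistrib (fun ω => (X i ω, Y i ω)) (fun ω => (X 0 ω, Y 0 ω)) P P)
    (hXY : IndepFun (X 0) (Y 0) P) (hYnonneg : ∀ᵐ ω ∂P, 0 ≤ Y 0 ω)
    (hXint : Integrable (X 0) P) (hgrif : ¬ GriffinCondition P (Y 0)) {ε : ℝ} (hε : 0 < ε) :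
    ∃ᶠ n in atTop, P.real {ω | ε ≤ |selfNormalizedSum X Y n ω - ∫ ω', X 0 ω' ∂P|} ≤ ε := by
  set μ := ∫ ω', X 0 ω' ∂P with hμ
  obtain ⟨f, C, hfm, hfC, hf0, hfδ⟩ :=
    exists_bounded_centred_approx (hX 0) hXint (show 0 < ε ^ 2 / 8 by positivity)
  rw [frequently_atTop]
  intro N
  -- The four exceptional events will have probabilities `2 / r`, `4 / r`, `16 C² / (ε² r)`, `ε / 2`.
  set K := 2 + 4 + 16 * C ^ 2 / ε ^ 2 with hK
  have hKpos : 0 < K := by positivity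
  set r := max (N : ℝ) (2 * K / ε) with hr_def
  have hr : 0 < r := lt_max_of_lt_right (by positivity)
  have hKr : K / r ≤ ε / 2 := by
    rw [div_le_iff₀ hr]
    have : 2 * K / ε ≤ r := le_max_right _ _
    rw [div_le_iff₀ hε] at this
    linarith
  obtain ⟨x, n, hrn, hnp, hm, hv⟩ := exists_level_of_not_griffin (hY 0) hYnonneg hgrif hr
  refine ⟨n, by exact_mod_cast (le_max_left _ _).trans hrn, ?_⟩
  have hn : (0 : ℝ) < n := hr.trans_le hrn
  have htm := measurable_truncAt x
  set m := ∫ ω, truncAt x (Y 0 ω) ∂P with hm_def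
  set v := ∫ ω, truncAt x (Y 0 ω) ^ 2 ∂P with hv_def
  have hvr : v / (n * m ^ 2) ≤ 1 / r := by
    rw [div_le_div_iff₀ (by positivity) hr]; linarith
  have hcomp {h : ℝ × ℝ → ℝ} (hh : Measurable h) :
      (Pairwise fun i j => IndepFun (fun ω => h (X i ω, Y i ω)) (fun ω => h (X j ω, Y j ω)) P) ∧
      ∀ i, IdentDistrib (fun ω => h (X i ω, Y i ω)) (fun ω => h (X 0 ω, Y 0 ω)) P P :=
    ⟨fun i j hij => (hindep.indepFun hij).comp hh hh, fun i => (hident i).comp hh⟩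
  have hprod {h : ℝ → ℝ} {k : ℝ → ℝ} (hh : Measurable h) (hk : Measurable k) :
      ∫ ω, h (X 0 ω) * k (Y 0 ω) ∂P = (∫ ω, h (X 0 ω) ∂P) * ∫ ω, k (Y 0 ω) ∂P :=
    (hXY.comp hh hk).integral_fun_mul_eq_mul_integral (hh.comp (hX 0)).aestronglyMeasurable
      (hk.comp (hY 0)).aestronglyMeasurable
  have hb : 0 < n * m := by positivity
  have hc : 0 < ε * (n * m) / 4 := by positivity
  have hA : P.real (⋃ i ∈ Finset.range n, {ω | x < Y i ω}) ≤ 2 / r := by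
    refine (measureReal_biUnion_finset_le _ _).trans (le_trans (le_of_eq ?_) hnp)
    have (i : ℕ) : P.real {ω | x < Y i ω} = P.real {ω | x < Y 0 ω} :=
      congrArg ENNReal.toReal (((hident i).comp measurable_snd).measure_mem_eq measurableSet_Ioi)
    simp [this]
  have hB : P.real {ω | n * m / 2 ≤ |∑ i ∈ Finset.range n, truncAt x (Y i ω) - n * m|} ≤
      4 / r := by
    obtain ⟨hi, hd⟩ := hcomp (htm.comp measurable_snd)
    refine (measureReal_abs_sum_sub_ge_le hi hd (memLp_truncAt (hY 0) hYnonneg x 2) n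
      (half_pos hb)).trans ?_
    change n * v / (n * m / 2) ^ 2 ≤ _
    calc n * v / (n * m / 2) ^ 2 = 4 * (v / (n * m ^ 2)) := by field_simp; norm_num
      _ ≤ 4 * (1 / r) := by gcongr
      _ = 4 / r := by ring
  have hF : P.real {ω | ε * (n * m) / 4 ≤
      |∑ i ∈ Finset.range n, f (X i ω) * truncAt x (Y i ω)|} ≤ 16 * C ^ 2 / ε ^ 2 / r := by
    obtain ⟨hi, hd⟩ := hcomp ((hfm.comp measurable_fst).mul (htm.comp measurable_snd))
    have hL2 : MemLp (fun ω => f (X 0 ω) * truncAt x (Y 0 ω)) 2 P := by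
      refine MemLp.of_bound (C := C * |x|)
        ((hfm.comp (hX 0)).mul (htm.comp (hY 0))).aestronglyMeasurable
        (hYnonneg.mono fun ω h => ?_)
      rw [Real.norm_eq_abs, abs_mul]
      exact mul_le_mul (hfC _) (abs_truncAt_le h) (abs_nonneg _) ((abs_nonneg _).trans (hfC 0))
    have hmean : ∫ ω, f (X 0 ω) * truncAt x (Y 0 ω) ∂P = 0 := by
      rw [hprod hfm htm, hf0, zero_mul]
    have hsq : ∫ ω, (f (X 0 ω) * truncAt x (Y 0 ω)) ^ 2 ∂P ≤ C ^ 2 * v := by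
      rw [hv_def, ← integral_const_mul]
      refine integral_mono hL2.integrable_sq
        ((memLp_truncAt (hY 0) hYnonneg x 2).integrable_sq.const_mul _) fun ω => ?_
      simp only [mul_pow]
      gcongr ?_ * _
      exact sq_le_sq.mpr ((hfC _).trans (le_abs_self C))
    have key := measureReal_abs_sum_sub_ge_le hi hd hL2 n hc
    change P.real {ω | _ ≤ |∑ i ∈ Finset.range n, f (X i ω) * truncAt x (Y i ω) -
      n * ∫ ω, f (X 0 ω) * truncAt x (Y 0 ω) ∂P|} ≤
      n * (∫ ω, (f (X 0 ω) * truncAt x (Y 0 ω)) ^ 2 ∂P) / _ at key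
    simp only [hmean, mul_zero, sub_zero] at key
    calc _ ≤ _ := key
      _ ≤ n * (C ^ 2 * v) / (ε * (n * m) / 4) ^ 2 := by gcongr
      _ = 16 * C ^ 2 / ε ^ 2 * (v / (n * m ^ 2)) := by field_simp; norm_num
      _ ≤ 16 * C ^ 2 / ε ^ 2 * (1 / r) := by gcongr
      _ = _ := by ring
  have hE : P.real {ω | ε * (n * m) / 4 ≤
      |∑ i ∈ Finset.range n, (X i ω - μ - f (X i ω)) * truncAt x (Y i ω)|} ≤ ε / 2 := by
    have hem : Measurable fun t => t - μ - f t := (measurable_id.sub_const μ).sub hfm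
    obtain ⟨-, hd⟩ := hcomp ((hem.comp measurable_fst).mul (htm.comp measurable_snd))
    have hei : Integrable (fun ω => X 0 ω - μ - f (X 0 ω)) P :=
      (hXint.sub (integrable_const μ)).sub
        (Integrable.of_bound (hfm.comp (hX 0)).aestronglyMeasurable C
          (Eventually.of_forall fun ω => hfC _))
    have hint : Integrable (fun ω => (X 0 ω - μ - f (X 0 ω)) * truncAt x (Y 0 ω)) P :=
      (hXY.comp hem htm).integrable_mul hei
        ((memLp_truncAt (hY 0) hYnonneg x 1).integrable le_rfl)
    have habs : ∫ ω, |(X 0 ω - μ - f (X 0 ω)) * truncAt x (Y 0 ω)| ∂P ≤ ε ^ 2 / 8 * m := by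
      simp only [abs_mul]
      rw [hprod (h := fun t => |t - μ - f t|) (k := fun t => |truncAt x t|) hem.abs htm.abs]
      have : ∫ ω, |truncAt x (Y 0 ω)| ∂P = m :=
        integral_congr_ae (hYnonneg.mono fun ω h => abs_of_nonneg (truncAt_nonneg h))
      rw [this]
      gcongr
    refine (measureReal_abs_sum_ge_le hd hint n hc).trans ?_
    calc n * (∫ ω, |(X 0 ω - μ - f (X 0 ω)) * truncAt x (Y 0 ω)| ∂P) / (ε * (n * m) / 4)
        ≤ n * (ε ^ 2 / 8 * m) / (ε * (n * m) / 4) := by gcongr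
      _ = ε / 2 := by field_simp; norm_num
  calc _ ≤ P.real ((⋃ i ∈ Finset.range n, {ω | x < Y i ω}) ∪
        {ω | n * m / 2 ≤ |∑ i ∈ Finset.range n, truncAt x (Y i ω) - n * m|} ∪
        {ω | ε * (n * m) / 4 ≤ |∑ i ∈ Finset.range n, f (X i ω) * truncAt x (Y i ω)|} ∪
        {ω | ε * (n * m) / 4 ≤
          |∑ i ∈ Finset.range n, (X i ω - μ - f (X i ω)) * truncAt x (Y i ω)|}) := by
        refine measureReal_mono fun ω hω => ?_
        by_contra hnot
        simp only [Set.mem_union, Set.mem_iUnion, Set.mem_ofPred_eq, not_or, not_exists,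
          not_le, not_lt] at hnot
        obtain ⟨⟨⟨h1, h2⟩, h3⟩, h4⟩ := hnot
        exact absurd (abs_selfNormalizedSum_sub_lt hb h1 h2 h3 h4) (not_lt.mpr hω)
    _ ≤ 2 / r + 4 / r + 16 * C ^ 2 / ε ^ 2 / r + ε / 2 := by
        refine (measureReal_union_le _ _).trans (add_le_add ?_ hE)
        refine (measureReal_union_le _ _).trans (add_le_add ?_ hF)
        exact (measureReal_union_le _ _).trans (add_le_add hA hB)
    _ = K / r + ε / 2 := by rw [hK]; ring
    _ ≤ ε := by linarith

end

theorem theorem8 {Ω : Type*} [MeasurableSpace Ω] (P : Measure Ω) [IsProbabilityMeasure P]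
    (X Y : ℕ → Ω → ℝ)
    (hX : ∀ i, Measurable (X i)) (hY : ∀ i, Measurable (Y i))
    (hindep : iIndepFun (fun i ω => (X i ω, Y i ω)) P)
    (hident : ∀ i, IdentDistrib (fun ω => (X i ω, Y i ω)) (fun ω => (X 0 ω, Y 0 ω)) P P)
    (hXY : IndepFun (X 0) (Y 0) P)
    (hYnonneg : ∀ᵐ ω ∂P, 0 ≤ Y 0 ω)
    (hYpos : 0 < P {ω | 0 < Y 0 ω})
    (hXint : Integrable (X 0) P)
    (hgrif : ¬ GriffinCondition P (Y 0)) :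
    ∃ φ : ℕ → ℕ, StrictMono φ ∧
      ∃ (Ω' : Type) (_ : MeasurableSpace Ω') (Q : Measure Ω') (_ : IsProbabilityMeasure Q)
        (T : Ω' → ℝ),
        TendstoInDistribution (fun k => selfNormalizedSum X Y (φ k)) atTop T (fun _ => P) Q ∧
        0 < Q {ω | T ω = ∫ ω', X 0 ω' ∂P} := by
  set μ := ∫ ω', X 0 ω' ∂P with hμ
  have hpos (k : ℕ) : 0 < 1 / ((k : ℝ) + 1) := by positivity
  obtain ⟨φ, hφ, hle⟩ := extraction_forall_of_frequently fun k : ℕ =>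
    frequently_measureReal_abs_sub_ge_le hX hY hindep hident hXY hYnonneg hXint hgrif (hpos k)
  have hconv : TendstoInMeasure P (fun k => selfNormalizedSum X Y (φ k)) atTop fun _ => μ := by
    rw [tendstoInMeasure_iff_measureReal_norm]
    intro ε hε
    refine squeeze_zero' (Eventually.of_forall fun k => measureReal_nonneg) ?_
      tendsto_one_div_add_atTop_nhds_zero_nat
    filter_upwards [tendsto_one_div_add_atTop_nhds_zero_nat.eventually_lt_const hε] with k hk
    exact (measureReal_mono fun ω hω => hk.le.trans hω).trans (hle k)
  have hmeas (k : ℕ) : AEMeasurable (selfNormalizedSum X Y (φ k)) P :=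
    ((Finset.measurable_sum _ fun i _ => (hX i).mul (hY i)).div
      (Finset.measurable_sum _ fun i _ => hY i)).aemeasurable
  -- The limit is the constant `E X`, realized on a one-point space.
  refine ⟨φ, hφ, Unit, inferInstance, Measure.dirac (), inferInstance, fun _ => μ, ?_, by simp⟩
  refine ⟨hmeas, by fun_prop, ?_⟩
  convert (hconv.tendstoInDistribution hmeas).tendsto using 3
  simp [Measure.map_const]
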